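/- For $n\ge r\ge 1$ let $X_r$ be the distance graph in the binary Hamming scheme $\mathcal{H}(n,2)$: its vertices are the binary words of length $n$, two words being adjacent if and only if they differ in exactly $r$ coordinates. For a finite graph $X$ with adjacency matrix $A(X)$, let $U(t)=e^{-\mathrm{i}tA(X)}$, $t\in\mathbb{R}$, and let $\mathbf{e}_a$ be the standard basis vector of the vertex $a$. Say that $X$ has balanced fractional revival at time $\tau>0$ if there are $\alpha,\beta\in\mathbb{C}$ with $|\alpha|=|\beta|=1/\sqrt{2}$ such that for every vertex $a$ of $X$ there is a vertex $b\neq a$ with $$U(\tau)\mathbf{e}_a=\alpha\,\mathbf{e}_a+\beta\,\mathbf{e}_b .$$ Proposition. Let $k\ge 4$ be an integer, and let $n=(2^{k-1}+1)2^{k+2}+3$ and $r=2^{k+3}+3$. Then the distance graph $X_r$ in $\mathcal{H}(n,2)$ has balanced fractional revival at time $\pi/2^k$. -/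

import Mathlib

/-- The distance graph `X_r` of the binary Hamming scheme `H(n,2)`: the vertices are the binary
words of length `n`, and two (distinct) words are joined exactly when they differ in exactly `r`
coordinates.  For `1 ≤ r` the distinctness is automatic. -/
def distanceGraph (n r : ℕ) : SimpleGraph (Fin n → Bool) where
  Adj x y := x ≠ y ∧ hammingDist x y = r
  symm := ⟨fun x y h => ⟨h.1.symm, by rw [hammingDist_comm]; exact h.2⟩⟩
  loopless := ⟨fun _ h => h.1 rfl⟩

instance (n r : ℕ) : DecidableRel (distanceGraph n r).Adj := fun x y =>
  inferInstanceAs (Decidable (x ≠ y ∧ hammingDist x y = r))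

/-- The transition matrix `U(t) = exp (-i t A(X))` of the continuous-time quantum walk on `X`. -/
noncomputable def transitionMatrix {V : Type*} [Fintype V] [DecidableEq V]
    (X : SimpleGraph V) [DecidableRel X.Adj] (t : ℝ) : Matrix V V ℂ :=
  NormedSpace.exp ((-Complex.I * (t : ℂ)) • X.adjMatrix ℂ)

/-- `(α, β)`-revival from `a` to `b` at time `τ`: `a ≠ b`, `τ > 0`, `β ≠ 0`, `|α|² + |β|² = 1` and
`U(τ) e_a = α e_a + β e_b`. -/
def HasRevivalFromTo {V : Type*} [Fintype V] [DecidableEq V]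
    (X : SimpleGraph V) [DecidableRel X.Adj] (α β : ℂ) (a b : V) (τ : ℝ) : Prop :=
  a ≠ b ∧ 0 < τ ∧ β ≠ 0 ∧ ‖α‖ ^ 2 + ‖β‖ ^ 2 = 1 ∧
    (transitionMatrix X τ).mulVec (Pi.single a 1) =
      α • (Pi.single a 1 : V → ℂ) + β • (Pi.single b 1 : V → ℂ)

/-- `X` has `(α, β)`-revival at time `τ`: it occurs, with the same `α`, `β`, `τ`, from every
vertex. -/
def HasRevival {V : Type*} [Fintype V] [DecidableEq V]
    (X : SimpleGraph V) [DecidableRel X.Adj] (α β : ℂ) (τ : ℝ) : Prop :=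
  ∀ a : V, ∃ b : V, HasRevivalFromTo X α β a b τ

/-- `X` has balanced fractional revival at time `τ`: it has `(α, β)`-revival at time `τ` for some
`α`, `β` with `|α| = |β| = 1/√2`. -/
def HasBalancedFractionalRevival {V : Type*} [Fintype V] [DecidableEq V]
    (X : SimpleGraph V) [DecidableRel X.Adj] (τ : ℝ) : Prop :=
  ∃ α β : ℂ, ‖α‖ = 1 / Real.sqrt 2 ∧ ‖β‖ = 1 / Real.sqrt 2 ∧ HasRevival X α β τ

open Polynomial in
/-- The Krawtchouk number `K_r(j)` of length `n`, the coefficient of `z ^ r` in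
`(1 - z) ^ j * (1 + z) ^ (n - j)`. -/
noncomputable def krawtchouk (n r j : ℕ) : ℤ :=
  (((1 : ℤ[X]) - X) ^ j * (1 + X) ^ (n - j)).coeff r

section Krawtchouk

open Polynomial

theorem krawtchouk_sub {n j : ℕ} (hj : j ≤ n) (r : ℕ) :
    krawtchouk n r (n - j) = (-1) ^ r * krawtchouk n r j := by
  have h : ((1 : ℤ[X]) - X) ^ (n - j) * (1 + X) ^ (n - (n - j)) =
      (((1 : ℤ[X]) - X) ^ j * (1 + X) ^ (n - j)).comp (C (-1) * X) := by
    rw [Nat.sub_sub_self hj]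
    simp only [mul_comp, pow_comp, sub_comp, add_comp, one_comp, X_comp, map_neg, map_one]
    ring
  rw [krawtchouk, h, comp_C_mul_X_coeff, krawtchouk, mul_comm]

theorem krawtchouk_two_mul {n m : ℕ} (hm : 2 * m ≤ n) (r : ℕ) :
    krawtchouk n r (2 * m) = ∑ i ∈ Finset.range (m + 1),
      (-4) ^ i * m.choose i * (if i ≤ r then ((n - 2 * i).choose (r - i) : ℤ) else 0) := by
  have h : ((1 : ℤ[X]) - X) ^ (2 * m) * (1 + X) ^ (n - 2 * m) =
      ∑ i ∈ Finset.range (m + 1),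
        C ((-4) ^ i * (m.choose i : ℤ)) * (X ^ i * (1 + X) ^ (n - 2 * i)) := by
    have h1 : ((1 : ℤ[X]) - X) ^ 2 = C (-4) * X + (1 + X) ^ 2 := by
      simp only [map_neg, map_ofNat]
      ring
    rw [pow_mul, h1, add_pow, Finset.sum_mul]
    refine Finset.sum_congr rfl fun i hi => ?_
    have hi' : i ≤ m := Nat.lt_succ_iff.mp (Finset.mem_range.mp hi)
    have h2 : n - 2 * i = 2 * (m - i) + (n - 2 * m) := by omega
    rw [h2, pow_add _ (2 * (m - i)), pow_mul]
    simp only [map_mul, map_pow, map_natCast, mul_pow]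
    ring
  rw [krawtchouk, h, finsetSum_coeff]
  refine Finset.sum_congr rfl fun i _ => ?_
  rw [coeff_C_mul, coeff_X_pow_mul', coeff_one_add_X_pow]

end Krawtchouk

/-- The carries counted by Kummer's theorem for `n = 2 ^ (2k+1) + 2 ^ (k+2) + 3 - 2i` and
`r = 2 ^ (k+3) + 3 - i`. -/
theorem two_pow_le_mod_add_mod {k e i : ℕ} (he : k + 4 ≤ e) (he' : e ≤ 2 * k + 1)
    (hi : i ≤ 2 ^ k) :
    2 ^ e ≤ (2 ^ (k + 3) + 3 - i) % 2 ^ e + (2 ^ (2 * k + 1) - 2 ^ (k + 2) - i) % 2 ^ e := by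
  obtain ⟨d, rfl⟩ := Nat.exists_eq_add_of_le he
  obtain ⟨c, hc⟩ := Nat.exists_eq_add_of_le he'
  have hP : 16 * 2 ^ k ≤ 2 ^ (k + 4 + d) :=
    (by rw [pow_add]; omega : 16 * 2 ^ k = 2 ^ (k + 4)).le.trans
      (Nat.pow_le_pow_right two_pos (Nat.le_add_right _ _))
  have hM : 1 ≤ 2 ^ k := Nat.one_le_two_pow
  have h3 : 2 ^ (k + 3) = 8 * 2 ^ k := by rw [pow_add]; omega
  have h2 : 2 ^ (k + 2) = 4 * 2 ^ k := by rw [pow_add]; omega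
  obtain ⟨s, hs⟩ : ∃ s, 2 ^ c = s + 1 := ⟨2 ^ c - 1, by have := Nat.one_le_two_pow (n := c); omega⟩
  have ha : 2 ^ (2 * k + 1) - 2 ^ (k + 2) - i =
      (2 ^ (k + 4 + d) - 4 * 2 ^ k - i) + 2 ^ (k + 4 + d) * s := by
    have : 2 ^ (2 * k + 1) = 2 ^ (k + 4 + d) * s + 2 ^ (k + 4 + d) := by
      rw [hc, pow_add _ _ c, hs, Nat.mul_succ]
    omega
  rw [ha, Nat.add_mul_mod_self_left, Nat.mod_eq_of_lt (by omega), Nat.mod_eq_of_lt (by omega)]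
  omega

theorem log_lt_of_le {k i : ℕ} (hk : 4 ≤ k) (hi : i ≤ 2 ^ k) :
    Nat.log 2 (2 ^ (2 * k + 1) - 2 ^ (k + 2) - i + (2 ^ (k + 3) + 3 - i)) < 2 * k + 2 := by
  refine Nat.log_lt_of_lt_pow' (by omega) ?_
  have h3 : 2 ^ (k + 3) = 8 * 2 ^ k := by rw [pow_add]; omega
  have h2 : 2 ^ (k + 2) = 4 * 2 ^ k := by rw [pow_add]; omega
  have h1 : 2 ^ (2 * k + 1) = 2 * (2 ^ k * 2 ^ k) := by rw [← pow_add, pow_succ]; ring_nf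
  have h0 : 2 ^ (2 * k + 2) = 4 * (2 ^ k * 2 ^ k) := by rw [← pow_add, pow_add]; ring_nf
  have hM : 16 ≤ 2 ^ k := (Nat.pow_le_pow_right two_pos hk : 2 ^ 4 ≤ 2 ^ k)
  have := Nat.mul_le_mul_right (2 ^ k) hM
  omega

theorem two_pow_dvd_choose {k i : ℕ} (hk : 4 ≤ k) (hi : i ≤ 2 ^ k) :
    2 ^ (k - 2) ∣ (2 ^ (2 * k + 1) - 2 ^ (k + 2) - i + (2 ^ (k + 3) + 3 - i)).choose
      (2 ^ (k + 3) + 3 - i) := by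
  have : Fact (Nat.Prime 2) := ⟨Nat.prime_two⟩
  rw [padicValNat_dvd_iff_le (Nat.choose_pos (Nat.le_add_left _ _)).ne',
    padicValNat_choose' (log_lt_of_le hk hi)]
  calc k - 2 = (Finset.Ico (k + 4) (2 * k + 2)).card := by rw [Nat.card_Ico]; omega
    _ ≤ _ := Finset.card_le_card fun e he => by
      rw [Finset.mem_Ico] at he
      rw [Finset.mem_filter, Finset.mem_Ico]
      exact ⟨by omega, two_pow_le_mod_add_mod he.1 (by omega) hi⟩

theorem two_pow_dvd_choose_one {k : ℕ} (hk : 4 ≤ k) :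
    2 ^ (k - 1) ∣ (2 ^ (2 * k + 1) - 2 ^ (k + 2) - 1 + (2 ^ (k + 3) + 3 - 1)).choose
      (2 ^ (k + 3) + 3 - 1) := by
  have : Fact (Nat.Prime 2) := ⟨Nat.prime_two⟩
  rw [padicValNat_dvd_iff_le (Nat.choose_pos (Nat.le_add_left _ _)).ne',
    padicValNat_choose' (log_lt_of_le hk Nat.one_le_two_pow)]
  calc k - 1 = (insert 2 (Finset.Ico (k + 4) (2 * k + 2))).card := by
        rw [Finset.card_insert_of_notMem (by simp), Nat.card_Ico]; omega
    _ ≤ _ := Finset.card_le_card fun e he => by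
      rw [Finset.mem_insert, Finset.mem_Ico] at he
      rw [Finset.mem_filter, Finset.mem_Ico]
      rcases he with rfl | he
      · refine ⟨by omega, ?_⟩
        have h3 : 2 ^ (k + 3) = 8 * 2 ^ k := by rw [pow_add]; omega
        have h2 : 2 ^ (k + 2) = 4 * 2 ^ k := by rw [pow_add]; omega
        have h1 : 2 ^ (2 * k + 1) = 2 * (2 ^ k * 2 ^ k) := by rw [← pow_add, pow_succ]; ring_nf
        have hM : 2 ^ k = 16 * 2 ^ (k - 4) := by
          rw [show (16 : ℕ) = 2 ^ 4 by norm_num, ← pow_add]; congr 1; omega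
        have hM' : 16 ≤ 2 ^ k := (Nat.pow_le_pow_right two_pos hk : 2 ^ 4 ≤ 2 ^ k)
        have h4 := Nat.mul_le_mul_right (2 ^ k) hM'
        have h5 : 2 ^ k * 2 ^ k = 16 * (2 ^ (k - 4) * 2 ^ k) := by
          rw [← mul_assoc, ← hM]
        omega
      · exact ⟨by omega, two_pow_le_mod_add_mod he.1 (by omega) Nat.one_le_two_pow⟩

theorem padicValNat_choose_eq {k : ℕ} (hk : 4 ≤ k) :
    padicValNat 2 ((2 ^ (2 * k + 1) - 2 ^ (k + 2) + (2 ^ (k + 3) + 3)).choose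
      (2 ^ (k + 3) + 3)) = k - 2 := by
  have : Fact (Nat.Prime 2) := ⟨Nat.prime_two⟩
  have h0 := log_lt_of_le hk (Nat.zero_le (2 ^ k))
  simp only [Nat.sub_zero] at h0
  rw [padicValNat_choose' h0]
  trans (Finset.Ico (k + 4) (2 * k + 2)).card
  swap
  · rw [Nat.card_Ico]; omega
  congr 1
  ext e
  rw [Finset.mem_filter, Finset.mem_Ico, Finset.mem_Ico]
  refine ⟨fun ⟨h1, h2⟩ => ⟨?_, h1.2⟩, fun h => ⟨by omega, ?_⟩⟩
  · by_contra! hlt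
    refine h2.not_gt ?_
    have h3 : 2 ^ (k + 3) = 8 * 2 ^ k := by rw [pow_add]; omega
    have h2 : 2 ^ (k + 2) = 4 * 2 ^ k := by rw [pow_add]; omega
    have hM : 16 ≤ 2 ^ k := (Nat.pow_le_pow_right two_pos hk : 2 ^ 4 ≤ 2 ^ k)
    have hr : (2 ^ (k + 3) + 3) % 2 ^ e = 3 % 2 ^ e := by
      rw [Nat.add_mod, Nat.mod_eq_zero_of_dvd (pow_dvd_pow 2 (by omega : e ≤ k + 3)), zero_add,
        Nat.mod_mod]
    rw [hr]
    rcases (by omega : e = k + 3 ∨ e ≤ k + 2) with rfl | he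
    · have h4 : 2 ^ (2 * k + 1) - 2 ^ (k + 2) =
          4 * 2 ^ k + 2 ^ (k + 3) * (2 ^ (k - 2) - 1) := by
        have h5 : 2 ^ (2 * k + 1) = 2 ^ (k + 3) * 2 ^ (k - 2) := by
          rw [← pow_add]; congr 1; omega
        have h6 : 1 ≤ 2 ^ (k - 2) := Nat.one_le_two_pow
        rw [Nat.mul_sub, ← h5]
        have := Nat.mul_le_mul_left (2 ^ (k + 3)) h6
        omega
      rw [h4, Nat.add_mul_mod_self_left, Nat.mod_eq_of_lt (by omega), Nat.mod_eq_of_lt (by omega)]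
      omega
    · rw [Nat.mod_eq_zero_of_dvd (Nat.dvd_sub (pow_dvd_pow 2 (by omega)) (pow_dvd_pow 2 he)),
        add_zero]
      exact Nat.mod_lt _ (by positivity)
  · simpa using two_pow_le_mod_add_mod h.1 (by omega) (Nat.zero_le (2 ^ k))

theorem two_pow_dvd_krawtchouk_sub {k m : ℕ} (hk : 4 ≤ k)
    (hm : 2 * m ≤ 2 ^ (2 * k + 1) + 2 ^ (k + 2) + 3) :
    (2 : ℤ) ^ (k + 1) ∣
      krawtchouk (2 ^ (2 * k + 1) + 2 ^ (k + 2) + 3) (2 ^ (k + 3) + 3) (2 * m) -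
      (2 ^ (2 * k + 1) + 2 ^ (k + 2) + 3).choose (2 ^ (k + 3) + 3) := by
  rw [krawtchouk_two_mul hm, Finset.sum_range_succ']
  simp only [pow_zero, Nat.choose_zero_right, Nat.cast_one, mul_one, Nat.zero_le, if_true,
    mul_zero, Nat.sub_zero, one_mul, add_sub_cancel_right]
  refine Finset.dvd_sum fun j _ => ?_
  generalize hij : j + 1 = i
  have h4 : (-4 : ℤ) ^ i = (-1) ^ i * 2 ^ (2 * i) := by rw [pow_mul, ← mul_pow]; norm_num
  rw [h4]
  by_cases hi : k + 1 ≤ 2 * i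
  · exact (((pow_dvd_pow 2 hi).mul_left _).mul_right _).mul_right _
  have hik : i ≤ 2 ^ k := by have := Nat.lt_two_pow_self (n := k); omega
  have h3 : 2 ^ (k + 3) = 8 * 2 ^ k := by rw [pow_add]; omega
  have h2 : 2 ^ (k + 2) = 4 * 2 ^ k := by rw [pow_add]; omega
  have h1 : 2 ^ (2 * k + 1) = 2 * (2 ^ k * 2 ^ k) := by rw [← pow_add, pow_succ]; ring_nf
  have hM' : 16 ≤ 2 ^ k := (Nat.pow_le_pow_right two_pos hk : 2 ^ 4 ≤ 2 ^ k)
  have h5 := Nat.mul_le_mul_right (2 ^ k) hM'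
  have hn : 2 ^ (2 * k + 1) + 2 ^ (k + 2) + 3 - 2 * i =
      2 ^ (2 * k + 1) - 2 ^ (k + 2) - i + (2 ^ (k + 3) + 3 - i) := by omega
  rw [if_pos (by omega), hn]
  have key : 2 ^ (k + 1 - 2 * i) ∣
      (2 ^ (2 * k + 1) - 2 ^ (k + 2) - i + (2 ^ (k + 3) + 3 - i)).choose
        (2 ^ (k + 3) + 3 - i) := by
    rcases (by omega : i = 1 ∨ 2 ≤ i) with rfl | hi2
    · exact two_pow_dvd_choose_one hk
    · exact (pow_dvd_pow 2 (by omega)).trans (two_pow_dvd_choose hk hik)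
  have key' : (2 : ℤ) ^ (k + 1 - 2 * i) ∣
      ((2 ^ (2 * k + 1) - 2 ^ (k + 2) - i + (2 ^ (k + 3) + 3 - i)).choose
        (2 ^ (k + 3) + 3 - i) : ℕ) := by exact_mod_cast key
  rw [show k + 1 = 2 * i + (k + 1 - 2 * i) by omega, pow_add]
  exact mul_dvd_mul (((dvd_refl _).mul_left _).mul_right _) key'

theorem choose_eq_two_pow_mul_odd {k : ℕ} (hk : 4 ≤ k) :
    ∃ c, (2 ^ (2 * k + 1) + 2 ^ (k + 2) + 3).choose (2 ^ (k + 3) + 3) =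
      2 ^ (k - 2) * (2 * c + 1) := by
  have : Fact (Nat.Prime 2) := ⟨Nat.prime_two⟩
  have h3 : 2 ^ (k + 3) = 2 * 2 ^ (k + 2) := by rw [pow_succ]; omega
  have h4 : 2 ^ (k + 2) ≤ 2 ^ (2 * k + 1) := Nat.pow_le_pow_right two_pos (by omega)
  have hn : 2 ^ (2 * k + 1) + 2 ^ (k + 2) + 3 =
      2 ^ (2 * k + 1) - 2 ^ (k + 2) + (2 ^ (k + 3) + 3) := by omega
  have hv := padicValNat_choose_eq hk
  rw [← hn] at hv
  set N := (2 ^ (2 * k + 1) + 2 ^ (k + 2) + 3).choose (2 ^ (k + 3) + 3) with hN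
  have hN0 : N ≠ 0 := (Nat.choose_pos (by omega)).ne'
  obtain ⟨q, hq⟩ := pow_padicValNat_dvd (p := 2) (n := N)
  have hodd := pow_succ_padicValNat_not_dvd (p := 2) hN0
  rw [hv] at hq hodd
  rcases Nat.even_or_odd' q with ⟨c, rfl | rfl⟩
  · exact absurd ⟨c, by rw [hq, pow_succ, mul_assoc]⟩ hodd
  · exact ⟨c, hq⟩

section Hadamard

open Polynomial

variable {n : ℕ}

/-- The Sylvester–Hadamard matrix, the character table of `(ℤ/2)ⁿ`. -/
def hadamardMatrix (n : ℕ) : Matrix (Fin n → Bool) (Fin n → Bool) ℂ :=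
  Matrix.of fun x y => ∏ i, if x i && y i then -1 else 1

/-- The Hamming weight of a binary word. -/
def hammingWeight (y : Fin n → Bool) : ℕ :=
  (Finset.univ.filter fun i => y i = true).card

/-- The permutation matrix of the complementation of binary words. -/
def antipodalMatrix (n : ℕ) : Matrix (Fin n → Bool) (Fin n → Bool) ℂ :=
  Matrix.of fun x y => if y = (fun i => !x i) then 1 else 0

theorem hammingWeight_le (y : Fin n → Bool) : hammingWeight y ≤ n :=
  (Finset.card_le_univ _).trans_eq (Fintype.card_fin n)

theorem prod_ite_eq_mul_pow {R : Type*} [CommMonoid R] (y : Fin n → Bool) (a b : R) :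
    ∏ i, (if y i then a else b) = a ^ hammingWeight y * b ^ (n - hammingWeight y) := by
  rw [Finset.prod_ite, Finset.prod_const, Finset.prod_const]
  congr 2
  have h := Finset.card_filter_add_card_filter_not (s := Finset.univ) (fun i => y i = true)
  rw [Finset.card_univ, Fintype.card_fin] at h
  exact Nat.eq_sub_of_add_eq' h

theorem hadamardMatrix_mul_self :
    hadamardMatrix n * hadamardMatrix n = (2 : ℂ) ^ n • (1 : Matrix _ _ ℂ) := by
  ext x z
  simp only [Matrix.mul_apply, hadamardMatrix, Matrix.of_apply, ← Finset.prod_mul_distrib,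
    Matrix.smul_apply, smul_eq_mul]
  rw [← Fintype.prod_sum
    (fun i (b : Bool) => (if x i && b then (-1 : ℂ) else 1) * (if b && z i then -1 else 1))]
  by_cases h : x = z
  · subst h
    rw [Matrix.one_apply_eq, mul_one]
    trans ∏ _i : Fin n, (2 : ℂ)
    · refine Finset.prod_congr rfl fun i _ => ?_
      cases x i <;> norm_num
    · simp
  · rw [Matrix.one_apply_ne h, mul_zero]
    obtain ⟨i, hi⟩ := Function.ne_iff.mp h
    refine Finset.prod_eq_zero (Finset.mem_univ i) ?_
    revert hi
    cases x i <;> cases z i <;> simp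

theorem isUnit_hadamardMatrix : IsUnit (hadamardMatrix n) := by
  refine IsUnit.of_mul_eq_one (((2 : ℂ) ^ n)⁻¹ • hadamardMatrix n) ?_
  rw [Matrix.mul_smul, hadamardMatrix_mul_self, smul_smul, inv_mul_cancel₀ (pow_ne_zero _ two_ne_zero),
    one_smul]

theorem antipodalMatrix_mul_hadamardMatrix :
    antipodalMatrix n * hadamardMatrix n =
      hadamardMatrix n * Matrix.diagonal fun y => (-1) ^ hammingWeight y := by
  ext x y
  rw [Matrix.mul_diagonal, Matrix.mul_apply]
  simp only [antipodalMatrix, Matrix.of_apply, ite_mul, one_mul, zero_mul, Finset.sum_ite_eq',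
    Finset.mem_univ, if_true, hadamardMatrix]
  have h := prod_ite_eq_mul_pow y (-1 : ℂ) 1
  rw [one_pow, mul_one] at h
  rw [← h, ← Finset.prod_mul_distrib]
  refine Finset.prod_congr rfl fun i _ => ?_
  by_cases hx : x i = true <;> by_cases hy : y i = true <;> simp [hx, hy]

theorem sum_hadamardMatrix_mul_X_pow (x y : Fin n → Bool) :
    ∑ z, C (hadamardMatrix n z y) * X ^ hammingDist x z =
      C (hadamardMatrix n x y) *
        ((1 - X) ^ hammingWeight y * (1 + X) ^ (n - hammingWeight y)) := by
  have h1 (z : Fin n → Bool) : C (hadamardMatrix n z y) * X ^ hammingDist x z =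
      ∏ i, (C (if z i && y i then -1 else 1) * if x i = z i then 1 else X : ℂ[X]) := by
    have hd : (X : ℂ[X]) ^ hammingDist x z = ∏ i, if x i = z i then 1 else X := by
      rw [Finset.prod_ite, Finset.prod_const_one, one_mul, Finset.prod_const]
      rfl
    rw [Finset.prod_mul_distrib, ← map_prod, hd]
    rfl
  simp_rw [h1]
  rw [← Fintype.prod_sum
    (fun i (b : Bool) => (C (if b && y i then -1 else 1) * if x i = b then 1 else X : ℂ[X])),
    ← prod_ite_eq_mul_pow, hadamardMatrix, Matrix.of_apply, map_prod, ← Finset.prod_mul_distrib]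
  refine Finset.prod_congr rfl fun i _ => ?_
  by_cases hx : x i = true <;> by_cases hy : y i = true <;> simp [hx, hy] <;> ring

theorem adjMatrix_mul_hadamardMatrix {r : ℕ} (hr : r ≠ 0) :
    (distanceGraph n r).adjMatrix ℂ * hadamardMatrix n =
      hadamardMatrix n * Matrix.diagonal fun y => (krawtchouk n r (hammingWeight y) : ℂ) := by
  ext x y
  rw [Matrix.mul_diagonal, Matrix.mul_apply]
  have h := congrArg (fun p => coeff p r) (sum_hadamardMatrix_mul_X_pow x y)
  simp only [finsetSum_coeff, coeff_C_mul] at h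
  have hK : (krawtchouk n r (hammingWeight y) : ℂ) =
      coeff ((1 - X) ^ hammingWeight y * (1 + X) ^ (n - hammingWeight y) : ℂ[X]) r := by
    rw [krawtchouk, ← eq_intCast (Int.castRingHom ℂ), ← coeff_map]
    simp
  rw [hK, ← h]
  refine Finset.sum_congr rfl fun z _ => ?_
  rw [SimpleGraph.adjMatrix_apply, coeff_X_pow, mul_comm]
  congr 1
  refine if_congr ⟨fun h => h.2.symm, fun h => ⟨?_, h.symm⟩⟩ rfl rfl
  rintro rfl
  exact hr (by rw [h, hammingDist_self])

theorem transitionMatrix_distanceGraph {r : ℕ} (hr : r ≠ 0) {t : ℝ} {α β : ℂ}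
    (h : ∀ j ≤ n, Complex.exp (-Complex.I * t * krawtchouk n r j) = α + β * (-1) ^ j) :
    transitionMatrix (distanceGraph n r) t = α • 1 + β • antipodalMatrix n := by
  have hU := isUnit_hadamardMatrix (n := n)
  have hdet := (Matrix.isUnit_iff_isUnit_det _).mp hU
  have hA : (-Complex.I * (t : ℂ)) • (distanceGraph n r).adjMatrix ℂ = hadamardMatrix n *
      (Matrix.diagonal fun y => -Complex.I * t * krawtchouk n r (hammingWeight y)) *
        (hadamardMatrix n)⁻¹ := by
    rw [← Matrix.mul_nonsing_inv_cancel_right _ ((distanceGraph n r).adjMatrix ℂ) hdet,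
      adjMatrix_mul_hadamardMatrix hr, ← Matrix.smul_mul, ← Matrix.mul_smul, ← Matrix.diagonal_smul]
    rfl
  rw [transitionMatrix, hA, Matrix.exp_conj _ _ hU, Matrix.exp_diagonal]
  have hD : NormedSpace.exp
      (fun y : Fin n → Bool => -Complex.I * t * krawtchouk n r (hammingWeight y)) =
      fun y => α + β * (-1) ^ hammingWeight y := by
    ext y
    rw [Pi.coe_exp, ← Complex.exp_eq_exp_ℂ, h _ (hammingWeight_le y)]
  have hD' : Matrix.diagonal (fun y : Fin n → Bool => α + β * (-1) ^ hammingWeight y) =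
      α • (1 : Matrix _ _ ℂ) + β • Matrix.diagonal fun y => (-1) ^ hammingWeight y := by
    rw [← Matrix.diagonal_one, ← Matrix.diagonal_smul, ← Matrix.diagonal_smul,
      Matrix.diagonal_add]
    congr 1
    ext y
    simp
  rw [hD, hD', Matrix.mul_add, Matrix.mul_smul, Matrix.mul_smul, Matrix.mul_one,
    ← antipodalMatrix_mul_hadamardMatrix, Matrix.add_mul, Matrix.smul_mul, Matrix.smul_mul,
    Matrix.mul_nonsing_inv _ hdet, Matrix.mul_nonsing_inv_cancel_right _ _ hdet]

end Hadamard

theorem hasRevival_distanceGraph {n r : ℕ} (hn : n ≠ 0) (hr : r ≠ 0) {t : ℝ} (ht : 0 < t)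
    {α β : ℂ} (hβ : β ≠ 0) (hαβ : ‖α‖ ^ 2 + ‖β‖ ^ 2 = 1)
    (h : ∀ j ≤ n, Complex.exp (-Complex.I * t * krawtchouk n r j) = α + β * (-1) ^ j) :
    HasRevival (distanceGraph n r) α β t := by
  intro a
  refine ⟨fun i => !a i, fun hab => ?_, ht, hβ, hαβ, ?_⟩
  · have := congrFun hab ⟨0, Nat.pos_of_ne_zero hn⟩
    simp at this
  · rw [transitionMatrix_distanceGraph hr h, Matrix.add_mulVec, Matrix.smul_mulVec,
      Matrix.smul_mulVec, Matrix.one_mulVec]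
    congr 2
    ext x
    rw [Matrix.mulVec_single_one, Matrix.col_apply, antipodalMatrix, Matrix.of_apply,
      Pi.single_apply]
    refine if_congr ⟨?_, ?_⟩ rfl rfl <;> rintro rfl <;> simp

theorem cos_two_mul_eq_zero_of_odd (c : ℕ) : Real.cos (2 * (Real.pi * (2 * c + 1) / 4)) = 0 :=
  Real.cos_eq_zero_iff.mpr ⟨c, by push_cast; ring⟩

theorem abs_eq_one_div_sqrt_two {x : ℝ} (h : x ^ 2 = 1 / 2) : |x| = 1 / Real.sqrt 2 := by
  rw [← Real.sqrt_sq_eq_abs, h, Real.sqrt_div zero_le_one, Real.sqrt_one]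

theorem exp_krawtchouk {k j : ℕ} {θ : ℝ} (hk : 4 ≤ k)
    (hθ : Real.pi / 2 ^ k * ((2 ^ (2 * k + 1) + 2 ^ (k + 2) + 3).choose (2 ^ (k + 3) + 3) : ℕ) = θ)
    (hj : j ≤ 2 ^ (2 * k + 1) + 2 ^ (k + 2) + 3) :
    Complex.exp (-Complex.I * (Real.pi / 2 ^ k : ℝ) *
      krawtchouk (2 ^ (2 * k + 1) + 2 ^ (k + 2) + 3) (2 ^ (k + 3) + 3) j) =
      (Real.cos θ : ℂ) + (-Complex.I * Real.sin θ) * (-1) ^ j := by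
  have hpow : (2 : ℂ) ^ k ≠ 0 := pow_ne_zero _ two_ne_zero
  have key (K : ℤ) (φ : ℝ) (N q : ℤ) (hφ : Real.pi / 2 ^ k * N = φ) (hK : K - N = 2 ^ (k + 1) * q) :
      Complex.exp (-Complex.I * (Real.pi / 2 ^ k : ℝ) * K) =
        (Real.cos φ : ℂ) + -Complex.I * Real.sin φ := by
    have h1 : -Complex.I * (Real.pi / 2 ^ k : ℝ) * K =
        ((-φ : ℝ) : ℂ) * Complex.I + ((-q : ℤ) : ℂ) * (2 * Real.pi * Complex.I) := by
      rw [← hφ, show K = N + 2 ^ (k + 1) * q by omega]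
      push_cast
      field_simp
      ring
    rw [h1, Complex.exp_add, Complex.exp_int_mul_two_pi_mul_I, mul_one, Complex.exp_mul_I]
    push_cast
    rw [Complex.cos_neg, Complex.sin_neg]
    ring
  rcases Nat.even_or_odd' j with ⟨m, rfl | rfl⟩
  · obtain ⟨q, hq⟩ := two_pow_dvd_krawtchouk_sub hk hj
    rw [key _ θ _ q (by exact_mod_cast hθ) hq, pow_mul]
    simp
  · have hp : 2 ^ (2 * k + 1) + 2 ^ (k + 2) + 3 = 2 * (2 ^ (2 * k) + 2 ^ (k + 1) + 1) + 1 := by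
      ring
    set n := 2 ^ (2 * k + 1) + 2 ^ (k + 2) + 3 with hn
    obtain ⟨m', hm'⟩ : ∃ m', n - (2 * m + 1) = 2 * m' :=
      ⟨2 ^ (2 * k) + 2 ^ (k + 1) + 1 - m, by omega⟩
    obtain ⟨q, hq⟩ := two_pow_dvd_krawtchouk_sub (m := m') hk (by omega)
    have hodd : Odd (2 ^ (k + 3) + 3) := ⟨2 ^ (k + 2) + 1, by ring⟩
    rw [← hn, ← hm', krawtchouk_sub hj, hodd.neg_one_pow] at hq
    rw [key _ (-θ) (-(n.choose (2 ^ (k + 3) + 3) : ℕ)) (-q)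
      (by rw [← hθ]; push_cast; ring) (by linarith), pow_succ, pow_mul]
    simp

theorem mainTheorem11 (k n r : ℕ) (hk : 4 ≤ k)
    (hn : n = (2 ^ (k - 1) + 1) * 2 ^ (k + 2) + 3) (hr : r = 2 ^ (k + 3) + 3) :
    HasBalancedFractionalRevival (distanceGraph n r) (Real.pi / 2 ^ k) := by
  have hn' : n = 2 ^ (2 * k + 1) + 2 ^ (k + 2) + 3 := by
    rw [hn, add_mul, one_mul, ← pow_add, show k - 1 + (k + 2) = 2 * k + 1 by omega]
  subst hn' hr
  obtain ⟨c, hc⟩ := choose_eq_two_pow_mul_odd hk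
  have hθ : Real.pi / 2 ^ k *
      ((2 ^ (2 * k + 1) + 2 ^ (k + 2) + 3).choose (2 ^ (k + 3) + 3) : ℕ) =
      Real.pi * (2 * c + 1) / 4 := by
    obtain ⟨l, rfl⟩ := Nat.exists_eq_add_of_le (by omega : 2 ≤ k)
    rw [hc, Nat.add_sub_cancel_left, pow_add]
    push_cast
    field_simp
    norm_num
  have h2 := cos_two_mul_eq_zero_of_odd c
  generalize Real.pi * (2 * c + 1) / 4 = θ at hθ h2
  have hcos : Real.cos θ ^ 2 = 1 / 2 := by rw [Real.cos_sq, h2]; norm_num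
  have hsin : Real.sin θ ^ 2 = 1 / 2 := by rw [Real.sin_sq, hcos]; norm_num
  have hα : ‖(Real.cos θ : ℂ)‖ = 1 / Real.sqrt 2 := by
    rw [Complex.norm_real, Real.norm_eq_abs, abs_eq_one_div_sqrt_two hcos]
  have hβ : ‖-Complex.I * (Real.sin θ : ℂ)‖ = 1 / Real.sqrt 2 := by
    rw [norm_mul, norm_neg, Complex.norm_I, one_mul, Complex.norm_real, Real.norm_eq_abs,
      abs_eq_one_div_sqrt_two hsin]
  refine ⟨Real.cos θ, -Complex.I * Real.sin θ, hα, hβ,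
    hasRevival_distanceGraph (Nat.succ_ne_zero _) (Nat.succ_ne_zero _) (by positivity) ?_ ?_
      fun j hj => exp_krawtchouk hk hθ hj⟩
  · rw [← norm_pos_iff, hβ]
    positivity
  · rw [hα, hβ, div_pow, Real.sq_sqrt zero_le_two]
    norm_num
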